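/- Let $K_1\subset\mathbb R^n$ be a polytope (the convex hull of finitely many points) with nonempty interior which is simple, that is, each vertex of $K_1$ lies in exactly $n$ facets. Let $u_1,\dots,u_N\in S^{n-1}$ be the (pairwise distinct) outer unit normals to the facets of $K_1$. Two polytopes $P,Q\subset\mathbb R^n$ are called strongly isomorphic if for every $\theta\in S^{n-1}$ the support sets $\{x\in P:\langle x,\theta\rangle=\sup_{y\in P}\langle y,\theta\rangle\}$ and $\{x\in Q:\langle x,\theta\rangle=\sup_{y\in Q}\langle y,\theta\rangle\}$ have the same affine dimension. For $h\in\mathbb R^N_+=\{h\in\mathbb R^N: h_j>0\text{ for all }j\}$ put $$K[h]=\{x\in\mathbb R^n:\langle x,u_j\rangle\le h_j\ \text{ for } j=1,\dots,N\},\qquad C=\{h\in\mathbb R^N_+: K[h]\text{ is strongly isomorphic to }K_1\}.$$ Then: (i) $C$ is a nonempty open convex cone in $\mathbb R^N$ with apex at zero, that is, $C$ is nonempty, open and convex, and $th\in C$ whenever $h\in C$ and $t>0$. (ii) Every polytope strongly isomorphic to $K_1$ and containing the origin in its interior equals $K[h]$ for a unique $h\in C$. (iii) For all $h,h'\in C$,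 $K[h+h']=K[h]+K[h']$ (Minkowski sum). -/

import Mathlib

open scoped Pointwise

namespace SimplePolytope

/-- A polytope in `ℝⁿ`: the convex hull of a finite set of points. -/
def IsPolytope {n : ℕ} (K : Set (EuclideanSpace ℝ (Fin n))) : Prop :=
  ∃ s : Finset (EuclideanSpace ℝ (Fin n)), K = convexHull ℝ (s : Set (EuclideanSpace ℝ (Fin n)))

/-- The support set of `K` in direction `θ`: the points of `K` at which `⟨θ, ·⟩` attains its
supremum over `K`. -/
def supportFace {n : ℕ} (K : Set (EuclideanSpace ℝ (Fin n))) (θ : EuclideanSpace ℝ (Fin n)) :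
    Set (EuclideanSpace ℝ (Fin n)) :=
  {x ∈ K | ∀ y ∈ K, inner ℝ y θ ≤ inner ℝ x θ}

/-- The affine dimension of a nonempty set: the dimension of the direction of its affine hull. -/
noncomputable def affineDim {n : ℕ} (A : Set (EuclideanSpace ℝ (Fin n))) : ℕ :=
  Module.finrank ℝ (vectorSpan ℝ A)

/-- `K` and `L` are strongly isomorphic: for every unit vector `θ`, the support sets of `K` and
of `L` in direction `θ` have the same affine dimension. -/
def StronglyIsomorphic {n : ℕ} (K L : Set (EuclideanSpace ℝ (Fin n))) : Prop :=
  ∀ θ : EuclideanSpace ℝ (Fin n), ‖θ‖ = 1 →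
    affineDim (supportFace K θ) = affineDim (supportFace L θ)

/-- The outer unit normals to the facets of `K`: the unit vectors `θ` whose support set has
affine dimension `n - 1`. -/
def facetNormals {n : ℕ} (K : Set (EuclideanSpace ℝ (Fin n))) :
    Set (EuclideanSpace ℝ (Fin n)) :=
  {θ | ‖θ‖ = 1 ∧ (supportFace K θ).Nonempty ∧ affineDim (supportFace K θ) + 1 = n}

/-- The facets of `K`: its `(n - 1)`-dimensional support sets. -/
def facets {n : ℕ} (K : Set (EuclideanSpace ℝ (Fin n))) :
    Set (Set (EuclideanSpace ℝ (Fin n))) :=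
  supportFace K '' facetNormals K

/-- `K` is simple: each of its vertices (extreme points) lies in exactly `n` facets. -/
def IsSimple {n : ℕ} (K : Set (EuclideanSpace ℝ (Fin n))) : Prop :=
  ∀ x ∈ Set.extremePoints ℝ K, {F ∈ facets K | x ∈ F}.encard = n

/-- `K[h] = {x : ⟨x, u_j⟩ ≤ h_j for all j}`. -/
def body {n N : ℕ} (u : Fin N → EuclideanSpace ℝ (Fin n)) (h : Fin N → ℝ) :
    Set (EuclideanSpace ℝ (Fin n)) :=
  {x | ∀ j, inner ℝ x (u j) ≤ h j}

/-- The set `C` of all `h` with positive coordinates for which `K[h]` is strongly isomorphic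
to `K`. -/
def typeCone {n N : ℕ} (K : Set (EuclideanSpace ℝ (Fin n)))
    (u : Fin N → EuclideanSpace ℝ (Fin n)) : Set (Fin N → ℝ) :=
  {h | (∀ j, 0 < h j) ∧ StronglyIsomorphic (body u h) K}

end SimplePolytope

/-! At each vertex of a simple polytope exactly `n` facet normals are active and they form a basis,
so the vertex normal cones are simplicial, and together they cover all directions. Let `fanCone`
consist of the `h` such that, for each vertex active set `J`, the equations indexed by `J` have a
solution satisfying every other constraint strictly. That solution is linear in `h`, so `fanCone` is
cut out by finitely many strict homogeneous linear inequalities: it is open, convex and stable under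
positive scaling.

For `θ = ∑ j ∈ J, c j • u j` with `c ≥ 0`, the face of `K[h]` in direction `θ` has direction space
`{z | ⟨z, u j⟩ = 0 whenever c j ≠ 0}`, which no longer involves `h`
(`mem_vectorSpan_supportFace_iff`). Hence all `h` in `fanCone` give strongly isomorphic bodies.
Their support functions are linear in `h` on each cone, which together with separation gives
additivity.

Conversely (`IsSimplicialFan.mem_fanCone`), strong isomorphism makes every face over the interior of
a cone a point; by connectedness it is a single point, where the constraints of `J` are tight, and a
further tight constraint would collapse a face of positive dimension. So `C` is the positive part of
`fanCone` (`typeCone_eq`). Representation by some `h` holds because a polytope is cut out by its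
facets (`IsPolytope.exists_facetNormal_lt`); uniqueness holds because each `h j` is the value
attained on a facet (`inner_eq_of_mem_facet`). -/

namespace SimplePolytope

open Filter Topology

/-! ### Support sets, and the facet description of a full-dimensional polytope. -/

section Faces

variable {n : ℕ} {K : Set (EuclideanSpace ℝ (Fin n))} {θ : EuclideanSpace ℝ (Fin n)}

theorem IsPolytope.isCompact (hK : IsPolytope K) : IsCompact K := by
  obtain ⟨s, rfl⟩ := hK
  exact s.finite_toSet.isCompact_convexHull ℝ

theorem IsPolytope.convex (hK : IsPolytope K) : Convex ℝ K := by
  obtain ⟨s, rfl⟩ := hK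
  exact convex_convexHull ℝ _

theorem isExposed_supportFace : IsExposed ℝ K (supportFace K θ) := by
  refine fun _ => ⟨innerSL ℝ θ, ?_⟩
  ext x
  simp [supportFace, real_inner_comm]

theorem supportFace_nonempty (hK : IsCompact K) (hne : K.Nonempty) :
    (supportFace K θ).Nonempty := by
  obtain ⟨x, hx, hmax⟩ := hK.exists_isMaxOn hne
    (f := fun y => inner ℝ y θ) (by fun_prop)
  exact ⟨x, hx, fun y hy => hmax hy⟩

theorem exists_extremePoint_mem_supportFace (hK : IsCompact K) (hne : K.Nonempty)
    (θ : EuclideanSpace ℝ (Fin n)) : ∃ v ∈ Set.extremePoints ℝ K, v ∈ supportFace K θ := by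
  have hF : IsCompact (supportFace K θ) := isExposed_supportFace.isCompact hK
  obtain ⟨v, hv⟩ := hF.extremePoints_nonempty (supportFace_nonempty hK hne)
  exact ⟨v, isExposed_supportFace.isExtreme.extremePoints_subset_extremePoints hv,
    extremePoints_subset hv⟩

theorem supportFace_smul {r : ℝ} (hr : 0 < r) : supportFace K (r • θ) = supportFace K θ := by
  ext x
  simp [supportFace, real_inner_smul_right, hr]

theorem inner_eq_of_mem_supportFace {x y : EuclideanSpace ℝ (Fin n)}
    (hx : x ∈ supportFace K θ) (hy : y ∈ supportFace K θ) : inner ℝ x θ = inner ℝ y θ :=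
  le_antisymm (hy.2 x hx.1) (hx.2 y hy.1)

/-- Krein–Milman applied to the face: its extreme points are extreme in the whole hull, hence belong
to `s`. -/
theorem supportFace_convexHull_subset (s : Finset (EuclideanSpace ℝ (Fin n))) :
    supportFace (convexHull ℝ (s : Set (EuclideanSpace ℝ (Fin n)))) θ ⊆
      convexHull ℝ ((s : Set (EuclideanSpace ℝ (Fin n))) ∩
        supportFace (convexHull ℝ (s : Set (EuclideanSpace ℝ (Fin n)))) θ) := by
  set K := convexHull ℝ (s : Set (EuclideanSpace ℝ (Fin n))) with hKdef
  have hK : IsCompact K := s.finite_toSet.isCompact_convexHull ℝ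
  have hF : IsCompact (supportFace K θ) := isExposed_supportFace.isCompact hK
  have hc : Convex ℝ (supportFace K θ) := isExposed_supportFace.convex (convex_convexHull ℝ _)
  have hfin : ((s : Set (EuclideanSpace ℝ (Fin n))) ∩ supportFace K θ).Finite :=
    s.finite_toSet.inter_of_left _
  have hsub : Set.extremePoints ℝ (supportFace K θ) ⊆
      (s : Set (EuclideanSpace ℝ (Fin n))) ∩ supportFace K θ := fun v hv =>
    ⟨extremePoints_convexHull_subset
      (isExposed_supportFace.isExtreme.extremePoints_subset_extremePoints hv),
      extremePoints_subset hv⟩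
  calc supportFace K θ = closure (convexHull ℝ (Set.extremePoints ℝ (supportFace K θ))) :=
        (closure_convexHull_extremePoints hF hc).symm
    _ ⊆ closure (convexHull ℝ ((s : Set (EuclideanSpace ℝ (Fin n))) ∩ supportFace K θ)) :=
        closure_mono (convexHull_mono hsub)
    _ = _ := (hfin.isCompact_convexHull ℝ).isClosed.closure_eq

/-- Two unit vectors orthogonal to a common hyperplane agree up to sign. -/
theorem eq_or_eq_neg_of_orthogonal (V : Submodule ℝ (EuclideanSpace ℝ (Fin n)))
    (hV : Module.finrank ℝ V + 1 = n) {θ θ' : EuclideanSpace ℝ (Fin n)} (hθ : ‖θ‖ = 1)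
    (hθ' : ‖θ'‖ = 1) (h : ∀ v ∈ V, inner ℝ v θ = 0) (h' : ∀ v ∈ V, inner ℝ v θ' = 0) :
    θ' = θ ∨ θ' = -θ := by
  have h1 : Module.finrank ℝ Vᗮ = 1 := by
    have := V.finrank_add_finrank_orthogonal
    rw [finrank_euclideanSpace_fin] at this
    omega
  have hne : (⟨θ, (V.mem_orthogonal θ).2 h⟩ : Vᗮ) ≠ 0 := by
    intro h0
    have : θ = 0 := congrArg Subtype.val h0
    simp [this] at hθ
  obtain ⟨c, hc⟩ := (finrank_eq_one_iff_of_nonzero' _ hne).1 h1 ⟨θ', (V.mem_orthogonal θ').2 h'⟩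
  have hc' : c • θ = θ' := congrArg Subtype.val hc
  have habs : |c| = 1 := by
    rw [← hc', norm_smul, hθ] at hθ'
    simpa using hθ'
  rcases eq_or_eq_neg_of_abs_eq habs with rfl | rfl
  · left; simpa using hc'.symm
  · right; simpa using hc'.symm

theorem inner_eq_zero_of_mem_vectorSpan {A : Set (EuclideanSpace ℝ (Fin n))}
    (hA : ∀ x ∈ A, ∀ y ∈ A, inner ℝ x θ = inner ℝ y θ) {v : EuclideanSpace ℝ (Fin n)}
    (hv : v ∈ vectorSpan ℝ A) : inner ℝ v θ = 0 := by
  rw [vectorSpan_def] at hv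
  induction hv using Submodule.span_induction with
  | mem x hx =>
    obtain ⟨a, ha, b, hb, rfl⟩ := hx
    simp [inner_sub_left, hA a ha b hb]
  | zero => simp
  | add x y _ _ hx hy => simp [inner_add_left, hx, hy]
  | smul a x _ hx => simp [real_inner_smul_left, hx]

theorem affineDim_add_one_le (hθ : θ ≠ 0) : affineDim (supportFace K θ) + 1 ≤ n := by
  have hle : vectorSpan ℝ (supportFace K θ) ≤ (ℝ ∙ θ)ᗮ := fun v hv => by
    rw [Submodule.mem_orthogonal_singleton_iff_inner_left]
    exact inner_eq_zero_of_mem_vectorSpan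
      (fun x hx y hy => inner_eq_of_mem_supportFace hx hy) hv
  have h1 := Submodule.finrank_mono hle
  have h2 := (ℝ ∙ θ).finrank_add_finrank_orthogonal
  rw [finrank_euclideanSpace_fin, finrank_span_singleton hθ] at h2
  unfold affineDim
  omega

/-- A point outside a convex compact set is seen from an interior point through a boundary point,
at which some supporting hyperplane separates strictly. -/
theorem exists_supporting_between (hK : IsCompact K) (hc : Convex ℝ K)
    {p x : EuclideanSpace ℝ (Fin n)} (hp : p ∈ interior K) (hx : x ∉ K) :
    ∃ θ : EuclideanSpace ℝ (Fin n), ‖θ‖ = 1 ∧ ∃ t : ℝ, t < 1 ∧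
      AffineMap.lineMap p x t ∈ supportFace K θ ∧
      ∀ y ∈ K, inner ℝ y θ < inner ℝ x θ := by
  have hcont : Continuous fun t : ℝ => AffineMap.lineMap p x t := AffineMap.lineMap_continuous
  have hA : IsCompact (Set.Icc (0 : ℝ) 1 ∩ (fun t : ℝ => AffineMap.lineMap p x t) ⁻¹' K) :=
    isCompact_Icc.inter_right (hK.isClosed.preimage hcont)
  -- The last point of the segment from `p` to `x` that lies in `K`; it cannot be interior.
  obtain ⟨t, ⟨⟨ht0, ht1⟩, htK⟩, hmax⟩ := hA.exists_isMaxOn (f := id)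
    ⟨0, ⟨by simp, by simpa using interior_subset hp⟩⟩ continuousOn_id
  have htK' : AffineMap.lineMap p x t ∈ K := htK
  have ht1' : t < 1 := by
    refine lt_of_le_of_ne ht1 ?_
    rintro rfl
    exact hx (by simpa using htK')
  have hy : AffineMap.lineMap p x t ∉ interior K := by
    intro hin
    have h1 : ∀ᶠ s in 𝓝[>] t, AffineMap.lineMap p x s ∈ interior K :=
      (hcont.continuousAt.eventually (isOpen_interior.mem_nhds hin)).filter_mono
        nhdsWithin_le_nhds
    have h2 : ∀ᶠ s in 𝓝[>] t, s < 1 :=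
      (eventually_lt_nhds ht1').filter_mono nhdsWithin_le_nhds
    obtain ⟨s, ⟨hs1, hs2⟩, hs3⟩ := ((h1.and h2).and self_mem_nhdsWithin).exists
    have hle : s ≤ t := hmax ⟨⟨ht0.trans (le_of_lt hs3), hs2.le⟩,
      show AffineMap.lineMap p x s ∈ K from interior_subset hs1⟩
    exact absurd hle (not_le.2 hs3)
  obtain ⟨f, hf⟩ := geometric_hahn_banach_open_point hc.interior isOpen_interior hy
  have hfle : ∀ a ∈ K, f a ≤ f (AffineMap.lineMap p x t) := by
    intro a ha
    have hcl : a ∈ closure (interior K) := by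
      rw [hc.closure_interior_eq_closure_of_nonempty_interior ⟨p, hp⟩]
      exact subset_closure ha
    have hclosed : IsClosed {b | f b ≤ f (AffineMap.lineMap p x t)} :=
      isClosed_le f.continuous continuous_const
    exact closure_minimal (fun b hb => (hf b hb).le) hclosed hcl
  have hfp := hf p hp
  have hline : f (AffineMap.lineMap p x t) = f p + t * (f x - f p) := by
    simp [AffineMap.lineMap_apply_module']
    ring
  -- `f` is strictly smaller at `p` than at the exit point, so it keeps increasing along the segment
  -- up to `x`.
  have hfx : f (AffineMap.lineMap p x t) < f x := by
    rw [hline] at hfp ⊢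
    have : 0 < f x - f p := by
      by_contra hneg
      nlinarith
    nlinarith
  set g := (InnerProductSpace.toDual ℝ (EuclideanSpace ℝ (Fin n))).symm f with hg
  have hgf : ∀ a, inner ℝ a g = f a := fun a => by
    rw [real_inner_comm, hg, InnerProductSpace.toDual_symm_apply]
  have hg0 : g ≠ 0 := by
    intro h0
    have := hgf p
    have h2 := hgf (AffineMap.lineMap p x t)
    rw [h0, inner_zero_right] at this h2
    rw [← this, ← h2] at hfp
    exact lt_irrefl _ hfp
  have hpos : 0 < ‖g‖⁻¹ := inv_pos.2 (norm_pos_iff.2 hg0)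
  refine ⟨‖g‖⁻¹ • g, by simp [norm_smul, hg0], t, ht1', ?_, fun y hy => ?_⟩
  · rw [supportFace_smul hpos]
    exact ⟨htK', fun y hy => by rw [hgf, hgf]; exact hfle y hy⟩
  · rw [real_inner_smul_right, real_inner_smul_right, hgf, hgf]
    exact mul_lt_mul_of_pos_left ((hfle y hy).trans_lt hfx) hpos

/-- A point outside a full-dimensional polytope is cut off by a facet. -/
theorem IsPolytope.exists_facetNormal_lt (hK : IsPolytope K) (hint : (interior K).Nonempty)
    {x : EuclideanSpace ℝ (Fin n)} (hx : x ∉ K) :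
    ∃ θ ∈ facetNormals K, ∀ y ∈ K, inner ℝ y θ < inner ℝ x θ := by
  have hcomp := hK.isCompact
  have hconv := hK.convex
  obtain ⟨s, hs⟩ := hK
  -- These sets could span faces of dimension at most `n - 2`. Adding `x` raises the dimension by at
  -- most one, so the resulting affine spans are finitely many null sets and a generic interior `p`
  -- avoids them all.
  let small : Set (Set (EuclideanSpace ℝ (Fin n))) :=
    {T | T ⊆ s ∧ Module.finrank ℝ (vectorSpan ℝ T) + 1 < n}
  have hsmall : small.Finite := s.finite_toSet.finite_subsets.subset fun T hT => hT.1
  have hzero : MeasureTheory.volume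
      (⋃ T ∈ small, (affineSpan ℝ (insert x T) : Set (EuclideanSpace ℝ (Fin n)))) = 0 := by
    rw [MeasureTheory.measure_biUnion_null_iff hsmall.countable]
    intro T hT
    refine MeasureTheory.Measure.addHaar_affineSubspace _ _ fun htop => ?_
    have h1 : vectorSpan ℝ (insert x T) = ⊤ := by
      rw [← direction_affineSpan, htop, AffineSubspace.direction_top]
    have h2 := finrank_vectorSpan_insert_le_set ℝ T x
    rw [h1, finrank_top, finrank_euclideanSpace_fin] at h2
    have := hT.2
    omega
  have hpos : 0 < MeasureTheory.volume (interior K) := isOpen_interior.measure_pos _ hint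
  obtain ⟨p, hp, hpbad⟩ : ∃ p ∈ interior K, p ∉
      ⋃ T ∈ small, (affineSpan ℝ (insert x T) : Set (EuclideanSpace ℝ (Fin n))) := by
    by_contra hcon
    push Not at hcon
    exact hpos.ne' (MeasureTheory.measure_mono_null hcon hzero)
  obtain ⟨θ, hθ, t, ht, hface, hlt⟩ := exists_supporting_between hcomp hconv hp hx
  refine ⟨θ, ⟨hθ, ⟨_, hface⟩, ?_⟩, hlt⟩
  by_contra hdim
  have hθ0 : θ ≠ 0 := fun h0 => by simp [h0] at hθ
  have hdim' := lt_of_le_of_ne (affineDim_add_one_le (K := K) hθ0) hdim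
  set T := (s : Set (EuclideanSpace ℝ (Fin n))) ∩ supportFace K θ with hT
  have hTs : T ∈ small := by
    refine ⟨Set.inter_subset_left, lt_of_le_of_lt ?_ hdim'⟩
    exact Nat.succ_le_succ
      (Submodule.finrank_mono (vectorSpan_mono ℝ Set.inter_subset_right))
  have hy : AffineMap.lineMap p x t ∈ affineSpan ℝ (insert x T) := by
    refine affineSpan_mono ℝ (Set.subset_insert x T) (convexHull_subset_affineSpan T ?_)
    subst hs
    exact supportFace_convexHull_subset s hface
  have hxm : x ∈ affineSpan ℝ (insert x T) := mem_affineSpan ℝ (Set.mem_insert x T)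
  -- `p` lies on the line through `x` and the exit point, so a face that is not a facet would
  -- contradict the genericity of `p`.
  have hpm : p ∈ affineSpan ℝ (insert x T) := by
    have := AffineMap.lineMap_mem (1 - t)⁻¹ hxm hy
    have h1 : (1 - t) ≠ 0 := by linarith
    convert this using 1
    simp only [AffineMap.lineMap_apply_module']
    have : t • (x - p) + p - x = (1 - t) • (p - x) := by module
    rw [this, smul_smul, inv_mul_cancel₀ h1]
    module
  exact hpbad (Set.mem_biUnion hTs hpm)

/-- A full-dimensional polytope is the intersection of its facet half-spaces. -/
theorem IsPolytope.eq_body {N : ℕ} (hK : IsPolytope K) (hint : (interior K).Nonempty)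
    {u : Fin N → EuclideanSpace ℝ (Fin n)} (hu : Set.range u = facetNormals K) :
    ∃ h : Fin N → ℝ, K = body u h := by
  have hmem : ∀ j, u j ∈ facetNormals K := fun j => hu ▸ Set.mem_range_self j
  choose x hx using fun j => (hmem j).2.1
  refine ⟨fun j => inner ℝ (x j) (u j), ?_⟩
  refine Set.Subset.antisymm (fun y hy j => (hx j).2 y hy) fun y hy => ?_
  by_contra hyK
  obtain ⟨θ, hθ, hlt⟩ := hK.exists_facetNormal_lt hint hyK
  obtain ⟨j, rfl⟩ := hu.symm ▸ hθ
  exact absurd (hy j) (not_le.2 (hlt _ (hx j).1))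

end Faces
-- Bodies `K[h]`: vertices, dual bases, and faces near a simple vertex.
section Body

variable {n N : ℕ} {u : Fin N → EuclideanSpace ℝ (Fin n)} {h : Fin N → ℝ}

theorem isClosed_body : IsClosed (body u h) := by
  have : body u h = ⋂ j, {x | inner ℝ x (u j) ≤ h j} := by
    ext x; simp [body]
  rw [this]
  exact isClosed_iInter fun j => isClosed_le (by fun_prop) continuous_const

theorem convex_body : Convex ℝ (body u h) := by
  intro x hx y hy a b ha hb hab j
  rw [inner_add_left, real_inner_smul_left, real_inner_smul_left]
  calc a * inner ℝ x (u j) + b * inner ℝ y (u j) ≤ a * h j + b * h j :=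
        add_le_add (mul_le_mul_of_nonneg_left (hx j) ha) (mul_le_mul_of_nonneg_left (hy j) hb)
    _ = h j := by rw [← add_mul, hab, one_mul]

/-- From a point of the body one can move a little in any direction that does not increase the
active constraints. -/
theorem eventually_add_smul_mem_body {x d : EuclideanSpace ℝ (Fin n)} (hx : x ∈ body u h)
    (hd : ∀ j, inner ℝ x (u j) = h j → inner ℝ d (u j) ≤ 0) :
    ∀ᶠ ε : ℝ in 𝓝[>] 0, x + ε • d ∈ body u h := by
  refine eventually_all.2 fun j => ?_
  rcases (hx j).eq_or_lt with heq | hlt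
  · filter_upwards [self_mem_nhdsWithin] with ε hε
    rw [inner_add_left, real_inner_smul_left, heq]
    have := mul_nonpos_of_nonneg_of_nonpos (le_of_lt hε) (hd j heq)
    linarith
  · have hcont : Continuous fun ε : ℝ => inner ℝ (x + ε • d) (u j) := by fun_prop
    have h0 : inner ℝ (x + (0 : ℝ) • d) (u j) < h j := by simpa using hlt
    exact ((hcont.continuousAt.eventually (gt_mem_nhds h0)).filter_mono
      nhdsWithin_le_nhds).mono fun _ hε => le_of_lt hε

/-- The active normals at an extreme point span the space. -/
theorem eq_zero_of_inner_active {v z : EuclideanSpace ℝ (Fin n)}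
    (hv : v ∈ Set.extremePoints ℝ (body u h))
    (hz : ∀ j, inner ℝ v (u j) = h j → inner ℝ z (u j) = 0) : z = 0 := by
  have h1 := eventually_add_smul_mem_body (d := z) hv.1 fun j hj => (hz j hj).le
  have h2 := eventually_add_smul_mem_body (d := -z) hv.1 fun j hj => by simp [hz j hj]
  obtain ⟨ε, ⟨hε1, hε2⟩, hε⟩ := ((h1.and h2).and self_mem_nhdsWithin).exists
  have hseg : v ∈ openSegment ℝ (v + ε • z) (v + ε • -z) :=
    ⟨1 / 2, 1 / 2, by norm_num, by norm_num, by norm_num, by module⟩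
  have := hv.2 hε1 hε2 hseg
  rw [add_eq_left, smul_eq_zero] at this
  exact this.resolve_left (ne_of_gt hε)

/-- A vertex is determined by its active set, and there are finitely many such sets. -/
theorem finite_extremePoints_body : (Set.extremePoints ℝ (body u h)).Finite := by
  refine Set.Finite.of_finite_image (f := fun v => {j | inner ℝ v (u j) = h j})
    (Set.toFinite _) fun v hv v' hv' hvv => sub_eq_zero.1 (eq_zero_of_inner_active hv fun j hj => ?_)
  have hj' : inner ℝ v' (u j) = h j := (Set.ext_iff.1 hvv j).1 hj
  rw [inner_sub_left, hj, hj', sub_self]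

/-- `w` is dual to the family `u` restricted to `J`, and both are bases of the space. -/
structure IsDualBasis (u : Fin N → EuclideanSpace ℝ (Fin n)) (J : Finset (Fin N))
    (w : Fin N → EuclideanSpace ℝ (Fin n)) : Prop where
  inner_eq : ∀ j ∈ J, ∀ k ∈ J, inner ℝ (w j) (u k) = if j = k then (1 : ℝ) else 0
  sum_left : ∀ x, x = ∑ j ∈ J, (inner ℝ x (u j) : ℝ) • w j
  sum_right : ∀ θ, θ = ∑ j ∈ J, (inner ℝ θ (w j) : ℝ) • u j

/-- The map `z ↦ (⟨z, u j⟩)` over `j ∈ J` is injective between spaces of equal dimension, so it is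
onto; preimages of the standard basis form the dual family. -/
theorem exists_isDualBasis {J : Finset (Fin N)} (hcard : J.card = n)
    (hspan : ∀ z, (∀ j ∈ J, inner ℝ z (u j) = (0 : ℝ)) → z = 0) : ∃ w, IsDualBasis u J w := by
  let T : EuclideanSpace ℝ (Fin n) →ₗ[ℝ] (J → ℝ) := LinearMap.pi fun j => (innerₗ _).flip (u j)
  have hT : ∀ z j, T z j = inner ℝ z (u j) := fun z j => rfl
  have hinj : Function.Injective T := by
    rw [injective_iff_map_eq_zero]
    intro z hz
    refine hspan z fun j hj => ?_
    rw [← hT z ⟨j, hj⟩, hz]; rfl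
  have hsurj : Function.Surjective T := by
    refine (LinearMap.injective_iff_surjective_of_finrank_eq_finrank ?_).1 hinj
    simp [hcard]
  choose g hg using fun j : J => hsurj (Pi.single j 1)
  let w : Fin N → EuclideanSpace ℝ (Fin n) := fun j => if hj : j ∈ J then g ⟨j, hj⟩ else 0
  have hw : ∀ j ∈ J, ∀ k ∈ J, inner ℝ (w j) (u k) = if j = k then (1 : ℝ) else 0 := by
    intro j hj k hk
    have := congrFun (hg ⟨j, hj⟩) ⟨k, hk⟩
    rw [hT] at this
    simp only [w, hj, dif_pos, this, Pi.single_apply, Subtype.mk.injEq, eq_comm (a := k)]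
  have hleft : ∀ x, x = ∑ j ∈ J, (inner ℝ x (u j) : ℝ) • w j := by
    intro x
    rw [← sub_eq_zero]
    refine hspan _ fun k hk => ?_
    rw [inner_sub_left, sum_inner, sub_eq_zero]
    rw [Finset.sum_congr rfl fun j hj => by rw [real_inner_smul_left, hw j hj k hk]]
    simp [hk]
  refine ⟨w, hw, hleft, fun θ => ext_inner_left ℝ fun z => ?_⟩
  conv_lhs => rw [hleft z]
  simp only [sum_inner, inner_sum, real_inner_smul_left, real_inner_smul_right]
  exact Finset.sum_congr rfl fun j _ => by rw [real_inner_comm (w j) θ, mul_comm]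

/-- At `x` exactly the constraints in `J` are active. -/
def TightAt (u : Fin N → EuclideanSpace ℝ (Fin n)) (h : Fin N → ℝ) (J : Finset (Fin N))
    (x : EuclideanSpace ℝ (Fin n)) : Prop :=
  (∀ j ∈ J, inner ℝ x (u j) = h j) ∧ ∀ j ∉ J, inner ℝ x (u j) < h j

variable {J : Finset (Fin N)} {x : EuclideanSpace ℝ (Fin n)}
  {w : Fin N → EuclideanSpace ℝ (Fin n)}

theorem TightAt.mem_body (hx : TightAt u h J x) : x ∈ body u h := fun j => by
  by_cases hj : j ∈ J
  · exact (hx.1 j hj).le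
  · exact (hx.2 j hj).le

theorem TightAt.mem_of_eq (hx : TightAt u h J x) {j : Fin N} (hj : inner ℝ x (u j) = h j) :
    j ∈ J := by
  by_contra hn
  exact (hx.2 j hn).ne hj

/-- Moving along `-w j` relaxes constraint `j` and keeps the rest of `J` tight: these are the edge
directions at a simple vertex. -/
theorem TightAt.eventually_sub_mem (hx : TightAt u h J x) (hw : IsDualBasis u J w) {j : Fin N}
    (hj : j ∈ J) : ∀ᶠ ε : ℝ in 𝓝[>] 0, x + ε • -w j ∈ body u h := by
  refine eventually_add_smul_mem_body hx.mem_body fun k hk => ?_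
  rw [inner_neg_left, hw.inner_eq j hj k (hx.mem_of_eq hk)]
  split_ifs <;> norm_num

/-- The outer normal cone at a simple vertex is generated by the active normals. -/
theorem TightAt.inner_nonneg (hx : TightAt u h J x) (hw : IsDualBasis u J w)
    {θ : EuclideanSpace ℝ (Fin n)} (hθ : x ∈ supportFace (body u h) θ) {j : Fin N} (hj : j ∈ J) :
    (0 : ℝ) ≤ inner ℝ θ (w j) := by
  obtain ⟨ε, hε, hpos⟩ := ((hx.eventually_sub_mem hw hj).and self_mem_nhdsWithin).exists
  have := hθ.2 _ hε
  rw [inner_add_left, real_inner_smul_left, inner_neg_left, real_inner_comm] at this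
  have hpos' : (0 : ℝ) < ε := hpos
  rw [real_inner_comm]
  nlinarith [real_inner_comm (w j) θ]

/-- The bound `∑ c j * ⟨y, u j⟩ ≤ ∑ c j * h j` is attained at `x`, so a maximizer must give equality
in every term of nonzero weight. -/
theorem supportFace_body_eq (hx : TightAt u h J x) {c : Fin N → ℝ} (hc : ∀ j ∈ J, 0 ≤ c j) :
    supportFace (body u h) (∑ j ∈ J, c j • u j) =
      {y ∈ body u h | ∀ j ∈ J, c j ≠ 0 → inner ℝ y (u j) = h j} := by
  have hexp : ∀ y, inner ℝ y (∑ j ∈ J, c j • u j) = ∑ j ∈ J, c j * inner ℝ y (u j) := fun y => by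
    simp [inner_sum, real_inner_smul_right]
  have hle : ∀ y ∈ body u h, ∀ j ∈ J, c j * inner ℝ y (u j) ≤ c j * h j := fun y hy j hj =>
    mul_le_mul_of_nonneg_left (hy j) (hc j hj)
  ext y
  constructor
  · rintro ⟨hy, hmax⟩
    refine ⟨hy, fun j hj hcj => ?_⟩
    have h1 := hmax x hx.mem_body
    rw [hexp, hexp, Finset.sum_congr rfl fun j hj => by rw [hx.1 j hj]] at h1
    have h2 := (Finset.sum_eq_sum_iff_of_le (hle y hy)).1
      (le_antisymm (Finset.sum_le_sum (hle y hy)) h1) j hj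
    exact mul_left_cancel₀ hcj h2
  · rintro ⟨hy, heq⟩
    refine ⟨hy, fun z hz => ?_⟩
    rw [hexp, hexp]
    refine (Finset.sum_le_sum (hle z hz)).trans_eq (Finset.sum_congr rfl fun j hj => ?_)
    by_cases hcj : c j = 0
    · simp [hcj]
    · rw [heq j hj hcj]

/-- The edges `-w j` with `c j = 0` stay in the face, and they span everything orthogonal to the
normals of nonzero weight. The criterion mentions neither `h` nor `x`, which is what makes different
bodies comparable. -/
theorem mem_vectorSpan_supportFace_iff (hx : TightAt u h J x) (hw : IsDualBasis u J w)
    {c : Fin N → ℝ} (hc : ∀ j ∈ J, 0 ≤ c j) {z : EuclideanSpace ℝ (Fin n)} :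
    z ∈ vectorSpan ℝ (supportFace (body u h) (∑ j ∈ J, c j • u j)) ↔
      ∀ j ∈ J, c j ≠ 0 → inner ℝ z (u j) = (0 : ℝ) := by
  rw [supportFace_body_eq hx hc]
  constructor
  · intro hz j hj hcj
    exact inner_eq_zero_of_mem_vectorSpan
      (fun y hy y' hy' => (hy.2 j hj hcj).trans (hy'.2 j hj hcj).symm) hz
  · intro hz
    rw [hw.sum_left z]
    refine Submodule.sum_mem _ fun j hj => ?_
    by_cases hcj : c j = 0
    · obtain ⟨ε, hε, hpos⟩ := ((hx.eventually_sub_mem hw hj).and self_mem_nhdsWithin).exists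
      have hmem := vsub_mem_vectorSpan ℝ
        (s := {y ∈ body u h | ∀ j ∈ J, c j ≠ 0 → inner ℝ y (u j) = h j})
        (p₁ := x) (p₂ := x + ε • -w j) ⟨hx.mem_body, fun k hk _ => hx.1 k hk⟩
        ⟨hε, fun k hk hck => by
          have hjk : j ≠ k := fun e => hck (e ▸ hcj)
          rw [inner_add_left, real_inner_smul_left, inner_neg_left, hw.inner_eq j hj k hk,
            if_neg hjk, hx.1 k hk]
          simp⟩
      have hpos' : ε ≠ 0 := ne_of_gt hpos
      have hwj : w j = ε⁻¹ • (x -ᵥ (x + ε • -w j)) := by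
        rw [vsub_eq_sub, sub_add_cancel_left, ← smul_neg, neg_neg, smul_smul,
          inv_mul_cancel₀ hpos', one_smul]
      refine Submodule.smul_mem _ _ ?_
      rw [hwj]
      exact Submodule.smul_mem _ _ hmem
    · rw [hz j hj hcj, zero_smul]
      exact Submodule.zero_mem _

theorem affineDim_supportFace_eq (hx : TightAt u h J x) (hw : IsDualBasis u J w)
    {h' : Fin N → ℝ} {x' : EuclideanSpace ℝ (Fin n)} (hx' : TightAt u h' J x')
    {c : Fin N → ℝ} (hc : ∀ j ∈ J, 0 ≤ c j) :
    affineDim (supportFace (body u h) (∑ j ∈ J, c j • u j)) =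
      affineDim (supportFace (body u h') (∑ j ∈ J, c j • u j)) := by
  have : vectorSpan ℝ (supportFace (body u h) (∑ j ∈ J, c j • u j)) =
      vectorSpan ℝ (supportFace (body u h') (∑ j ∈ J, c j • u j)) := by
    ext z
    rw [mem_vectorSpan_supportFace_iff hx hw hc, mem_vectorSpan_supportFace_iff hx' hw hc]
  rw [affineDim, affineDim, this]

theorem affineDim_supportFace_eq_zero_iff (hx : TightAt u h J x) (hw : IsDualBasis u J w)
    {c : Fin N → ℝ} (hc : ∀ j ∈ J, 0 ≤ c j) :
    affineDim (supportFace (body u h) (∑ j ∈ J, c j • u j)) = 0 ↔ ∀ j ∈ J, 0 < c j := by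
  rw [affineDim, Submodule.finrank_eq_zero, Submodule.eq_bot_iff]
  simp only [mem_vectorSpan_supportFace_iff hx hw hc]
  constructor
  · intro hz j hj
    refine lt_of_le_of_ne (hc j hj) fun hcj => ?_
    have h0 := hz (w j) fun k hk hck => by
      rw [hw.inner_eq j hj k hk, if_neg (fun e : j = k => hck (e ▸ hcj.symm))]
    have := hw.inner_eq j hj j hj
    simp [h0] at this
  · intro hpos z hz
    rw [hw.sum_left z]
    exact Finset.sum_eq_zero fun j hj => by rw [hz j hj (hpos j hj).ne', zero_smul]

theorem subsingleton_of_affineDim_eq_zero {A : Set (EuclideanSpace ℝ (Fin n))}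
    (hA : affineDim A = 0) : A.Subsingleton := by
  intro y hy z hz
  rw [affineDim, Submodule.finrank_eq_zero] at hA
  have := vsub_mem_vectorSpan ℝ hy hz
  rw [hA, Submodule.mem_bot, vsub_eq_sub, sub_eq_zero] at this
  exact this

theorem affineDim_eq_zero_of_subsingleton {A : Set (EuclideanSpace ℝ (Fin n))}
    (hA : A.Subsingleton) : affineDim A = 0 := by
  rw [affineDim, vectorSpan_of_subsingleton ℝ hA, finrank_bot]

theorem StronglyIsomorphic.affineDim_eq {K L : Set (EuclideanSpace ℝ (Fin n))}
    (hKL : StronglyIsomorphic K L) {θ : EuclideanSpace ℝ (Fin n)} (hθ : θ ≠ 0) :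
    affineDim (supportFace K θ) = affineDim (supportFace L θ) := by
  have hpos : 0 < ‖θ‖⁻¹ := inv_pos.2 (norm_pos_iff.2 hθ)
  have := hKL (‖θ‖⁻¹ • θ) (by simp [norm_smul, hθ])
  rwa [supportFace_smul hpos, supportFace_smul hpos] at this

/-- Boundedness of a body with nonempty interior depends only on the normals. -/
theorem isCompact_body {h₀ : Fin N → ℝ} {p : EuclideanSpace ℝ (Fin n)}
    (hcomp : IsCompact (body u h₀)) (hp : ∀ j, inner ℝ p (u j) < h₀ j) :
    IsCompact (body u h) := by
  -- For such `t`, the body for `h` sits inside the image of the body for `h₀` under `y ↦ t • (y -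
  -- p)`.
  obtain ⟨t, ht0, ht⟩ : ∃ t : ℝ, 0 < t ∧ ∀ j, h j ≤ t * (h₀ j - inner ℝ p (u j)) := by
    have h1 : ∀ᶠ t : ℝ in atTop, ∀ j, h j ≤ t * (h₀ j - inner ℝ p (u j)) :=
      eventually_all.2 fun j =>
        (tendsto_id.atTop_mul_const (sub_pos.2 (hp j))).eventually_ge_atTop (h j)
    exact ((eventually_gt_atTop 0).and h1).exists
  have himg : IsCompact ((fun y => t • (y - p)) '' body u h₀) := hcomp.image (by fun_prop)
  refine himg.of_isClosed_subset isClosed_body fun y hy => ⟨t⁻¹ • y + p, fun j => ?_, ?_⟩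
  · rw [inner_add_left, real_inner_smul_left]
    have h2 := (hy j).trans (ht j)
    have h3 : t⁻¹ * inner ℝ y (u j) ≤ h₀ j - inner ℝ p (u j) := by
      rwa [inv_mul_le_iff₀ ht0]
    linarith
  · simp [smul_smul, ht0.ne']

theorem inner_lt_of_mem_interior_body {p : EuclideanSpace ℝ (Fin n)}
    (hp : p ∈ interior (body u h)) {j : Fin N} (hj : u j ≠ 0) : inner ℝ p (u j) < h j := by
  have hcont : Continuous fun ε : ℝ => p + ε • u j := by fun_prop
  have h1 : ∀ᶠ ε : ℝ in 𝓝[>] 0, p + ε • u j ∈ body u h :=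
    ((hcont.tendsto 0).eventually
      (by simpa using mem_interior_iff_mem_nhds.1 hp)).filter_mono nhdsWithin_le_nhds
  obtain ⟨ε, hε, hpos⟩ := (h1.and self_mem_nhdsWithin).exists
  have := hε j
  rw [inner_add_left, real_inner_smul_left] at this
  have hpos' : (0 : ℝ) < ε := hpos
  have := mul_pos hpos' (real_inner_self_pos.2 hj)
  linarith

/-- In a body all of whose right-hand sides cut facets, every constraint is attained. -/
theorem inner_eq_of_mem_facet (hu_inj : Function.Injective u) (hu : ∀ j, ‖u j‖ = 1)
    {j : Fin N} (hdim : affineDim (supportFace (body u h) (u j)) + 1 = n)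
    {y : EuclideanSpace ℝ (Fin n)} (hy : y ∈ supportFace (body u h) (u j)) :
    inner ℝ y (u j) = h j := by
  set F := supportFace (body u h) (u j) with hF
  by_contra hne
  have hlt : ∀ z ∈ F, inner ℝ z (u j) < h j := fun z hz => by
    rw [inner_eq_of_mem_supportFace hz hy]
    exact lt_of_le_of_ne (hy.1 j) hne
  have hFc : Convex ℝ F := isExposed_supportFace.convex convex_body
  -- For each constraint, choose a point of `F` where it is slack if there is one. The average `x`
  -- of these points has only those constraints active that are active on all of `F`.
  have hex : ∀ i, ∃ p ∈ F, inner ℝ p (u i) = h i → ∀ z ∈ F, inner ℝ z (u i) = h i := fun i => by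
    by_cases hall : ∀ z ∈ F, inner ℝ z (u i) = h i
    · exact ⟨y, hy, fun _ => hall⟩
    · push Not at hall
      obtain ⟨z, hz, hzi⟩ := hall
      exact ⟨z, hz, fun e => absurd e hzi⟩
  choose p hpF hp using hex
  have hN : (0 : ℝ) < N := by
    have := j.pos
    exact_mod_cast this
  set x := ∑ i, (N : ℝ)⁻¹ • p i with hxdef
  have hxF : x ∈ F := hFc.sum_mem (fun _ _ => (inv_pos.2 hN).le)
    (by simp [hN.ne']) fun i _ => hpF i
  have hact : ∀ i, inner ℝ x (u i) = h i → ∀ z ∈ F, inner ℝ z (u i) = h i := by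
    intro i hi
    refine hp i ?_
    have hle : ∀ k ∈ Finset.univ, (N : ℝ)⁻¹ * inner ℝ (p k) (u i) ≤ (N : ℝ)⁻¹ * h i :=
      fun k _ => mul_le_mul_of_nonneg_left ((hpF k).1 i) (inv_pos.2 hN).le
    have hsum : ∑ k, (N : ℝ)⁻¹ * inner ℝ (p k) (u i) = ∑ _k : Fin N, (N : ℝ)⁻¹ * h i := by
      rw [hxdef, sum_inner] at hi
      simp only [real_inner_smul_left] at hi
      rw [hi]
      simp [hN.ne']
    exact mul_left_cancel₀ (inv_pos.2 hN).ne'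
      ((Finset.sum_eq_sum_iff_of_le hle).1 hsum i (Finset.mem_univ i))
  -- A normal active at `x` is orthogonal to `F`, hence `± u j`; `u j` itself is slack by assumption
  -- and `-u j` does not block. So `x` can move outward, against its maximality.
  have hmove : ∀ᶠ ε : ℝ in 𝓝[>] 0, x + ε • u j ∈ body u h := by
    refine eventually_add_smul_mem_body hxF.1 fun i hi => ?_
    rcases eq_or_eq_neg_of_orthogonal (vectorSpan ℝ F) hdim (hu j) (hu i)
      (fun v hv => inner_eq_zero_of_mem_vectorSpan
        (fun a ha b hb => inner_eq_of_mem_supportFace ha hb) hv)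
      (fun v hv => inner_eq_zero_of_mem_vectorSpan
        (fun a ha b hb => (hact i hi a ha).trans (hact i hi b hb).symm) hv) with e | e
    · rw [hu_inj e] at hi
      exact absurd hi (hlt x hxF).ne
    · rw [e, inner_neg_right, Left.neg_nonpos_iff]
      exact real_inner_self_nonneg
  obtain ⟨ε, hε, hpos⟩ := (hmove.and self_mem_nhdsWithin).exists
  have hcon := hxF.2 _ hε
  have hpos' : (0 : ℝ) < ε := hpos
  rw [inner_add_left, real_inner_smul_left, real_inner_self_eq_norm_sq, hu j] at hcon
  linarith

/-- Over a connected set of directions all of whose support sets are points, the support set is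
constant. -/
theorem exists_forall_mem_supportFace {Q D : Set (EuclideanSpace ℝ (Fin n))} (hQ : IsCompact Q)
    (hne : Q.Nonempty) (hfin : (Set.extremePoints ℝ Q).Finite) (hD : IsPreconnected D)
    (hDne : D.Nonempty) (hsub : ∀ θ ∈ D, (supportFace Q θ).Subsingleton) :
    ∃ q ∈ Q, ∀ θ ∈ D, q ∈ supportFace Q θ := by
  have hclosed : ∀ v ∈ Q, IsClosed {θ | v ∈ supportFace Q θ} := fun v hv => by
    have : {θ | v ∈ supportFace Q θ} = ⋂ y ∈ Q, {θ | inner ℝ y θ ≤ inner ℝ v θ} := by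
      ext θ; simp [supportFace, hv]
    rw [this]
    exact isClosed_biInter fun y _ => isClosed_le (by fun_prop) (by fun_prop)
  obtain ⟨θ₀, hθ₀⟩ := hDne
  obtain ⟨q, hq, hqθ₀⟩ := exists_extremePoint_mem_supportFace hQ hne θ₀
  refine ⟨q, hq.1, fun θ hθ => ?_⟩
  by_contra hcon
  -- The normal cone of `q` and the union of the normal cones of the other vertices are closed,
  -- cover `D`, and cannot meet inside `D`.
  set R := Set.extremePoints ℝ Q \ {q}
  have hR : IsClosed (⋃ v ∈ R, {θ | v ∈ supportFace Q θ}) :=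
    (hfin.subset Set.sdiff_subset).isClosed_biUnion fun v hv => hclosed v hv.1.1
  have hcover : D ⊆ {θ | q ∈ supportFace Q θ} ∪ ⋃ v ∈ R, {θ | v ∈ supportFace Q θ} := by
    intro η _
    obtain ⟨v, hv, hvη⟩ := exists_extremePoint_mem_supportFace hQ hne η
    by_cases hvq : v = q
    · exact Or.inl (hvq ▸ hvη)
    · exact Or.inr (Set.mem_biUnion (show v ∈ R from ⟨hv, hvq⟩) hvη)
  obtain ⟨η, hη, hη1, hη2⟩ := isPreconnected_closed_iff.1 hD _ _ (hclosed q hq.1) hR hcover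
    ⟨θ₀, hθ₀, hqθ₀⟩ ⟨θ, hθ, (hcover hθ).resolve_left hcon⟩
  obtain ⟨v, hv, hvη⟩ := Set.mem_iUnion₂.1 hη2
  exact hv.2 (hsub η hη hvη hη1)

end Body
-- Complete simplicial fans and the cone of compatible right-hand sides.
section Fan

variable {n N : ℕ} {u : Fin N → EuclideanSpace ℝ (Fin n)} {𝒥 : Set (Finset (Fin N))}

/-- A complete simplicial fan: each index set in `𝒥` gives a basis, and the generated cones cover
the space. -/
structure IsSimplicialFan (u : Fin N → EuclideanSpace ℝ (Fin n)) (𝒥 : Set (Finset (Fin N))) :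
    Prop where
  exists_dual : ∀ J ∈ 𝒥, ∃ w, IsDualBasis u J w
  cover : ∀ θ, ∃ J ∈ 𝒥, ∃ c : Fin N → ℝ, (∀ j ∈ J, 0 ≤ c j) ∧ ∑ j ∈ J, c j • u j = θ

/-- The right-hand sides whose body has a vertex with active set `J` for each `J ∈ 𝒥`. -/
def fanCone (u : Fin N → EuclideanSpace ℝ (Fin n)) (𝒥 : Set (Finset (Fin N))) :
    Set (Fin N → ℝ) :=
  {h | ∀ J ∈ 𝒥, ∃ x, TightAt u h J x}

theorem TightAt.add {h h' : Fin N → ℝ} {J : Finset (Fin N)} {x x' : EuclideanSpace ℝ (Fin n)}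
    (hx : TightAt u h J x) (hx' : TightAt u h' J x') : TightAt u (h + h') J (x + x') :=
  ⟨fun j hj => by rw [inner_add_left, hx.1 j hj, hx'.1 j hj, Pi.add_apply],
    fun j hj => by
      rw [inner_add_left, Pi.add_apply]
      exact add_lt_add (hx.2 j hj) (hx'.2 j hj)⟩

theorem TightAt.smul {h : Fin N → ℝ} {J : Finset (Fin N)} {x : EuclideanSpace ℝ (Fin n)}
    (hx : TightAt u h J x) {t : ℝ} (ht : 0 < t) : TightAt u (t • h) J (t • x) :=
  ⟨fun j hj => by rw [real_inner_smul_left, hx.1 j hj, Pi.smul_apply, smul_eq_mul],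
    fun j hj => by
      rw [real_inner_smul_left, Pi.smul_apply, smul_eq_mul]
      exact mul_lt_mul_of_pos_left (hx.2 j hj) ht⟩

theorem smul_mem_fanCone {h : Fin N → ℝ} (hh : h ∈ fanCone u 𝒥) {t : ℝ} (ht : 0 < t) :
    t • h ∈ fanCone u 𝒥 := fun J hJ =>
  let ⟨_, hx⟩ := hh J hJ
  ⟨_, hx.smul ht⟩

theorem add_mem_fanCone {h h' : Fin N → ℝ} (hh : h ∈ fanCone u 𝒥) (hh' : h' ∈ fanCone u 𝒥) :
    h + h' ∈ fanCone u 𝒥 := fun J hJ =>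
  let ⟨_, hx⟩ := hh J hJ
  let ⟨_, hx'⟩ := hh' J hJ
  ⟨_, hx.add hx'⟩

theorem convex_fanCone : Convex ℝ (fanCone u 𝒥) := by
  refine convex_iff_forall_pos.2 fun h hh h' hh' a b ha hb _ => ?_
  exact add_mem_fanCone (smul_mem_fanCone hh ha) (smul_mem_fanCone hh' hb)

/-- The equations indexed by `J` force the vertex to be `∑ h j • w j`; the remaining conditions are
then strict linear inequalities in `h`, whence openness. -/
theorem IsDualBasis.exists_tightAt_iff {J : Finset (Fin N)} {w : Fin N → EuclideanSpace ℝ (Fin n)}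
    (hw : IsDualBasis u J w) {h : Fin N → ℝ} :
    (∃ x, TightAt u h J x) ↔ ∀ i ∉ J, inner ℝ (∑ j ∈ J, h j • w j) (u i) < h i := by
  constructor
  · rintro ⟨x, hx⟩ i hi
    have : x = ∑ j ∈ J, h j • w j :=
      (hw.sum_left x).trans (Finset.sum_congr rfl fun j hj => by rw [hx.1 j hj])
    rw [← this]
    exact hx.2 i hi
  · refine fun hi => ⟨∑ j ∈ J, h j • w j, fun k hk => ?_, hi⟩
    rw [sum_inner, Finset.sum_congr rfl fun j hj => by
      rw [real_inner_smul_left, hw.inner_eq j hj k hk]]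
    simp [hk]

theorem IsSimplicialFan.isOpen_fanCone (hF : IsSimplicialFan u 𝒥) : IsOpen (fanCone u 𝒥) := by
  have : fanCone u 𝒥 = ⋂ J ∈ 𝒥, {h | ∃ x, TightAt u h J x} := by
    ext h; simp [fanCone]
  rw [this]
  refine (Set.toFinite 𝒥).isOpen_biInter fun J hJ => ?_
  obtain ⟨w, hw⟩ := hF.exists_dual J hJ
  have hset : {h | ∃ x, TightAt u h J x} =
      ⋂ i, ⋂ _ : i ∉ J, {h | inner ℝ (∑ j ∈ J, h j • w j) (u i) < h i} := by
    ext h; simp [hw.exists_tightAt_iff]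
  rw [hset]
  exact isOpen_iInter_of_finite fun i => isOpen_iInter_of_finite fun _ =>
    isOpen_lt (by fun_prop) (by fun_prop)

theorem IsSimplicialFan.stronglyIsomorphic (hF : IsSimplicialFan u 𝒥) {h h' : Fin N → ℝ}
    (hh : h ∈ fanCone u 𝒥) (hh' : h' ∈ fanCone u 𝒥) :
    StronglyIsomorphic (body u h) (body u h') := by
  intro θ _
  obtain ⟨J, hJ, c, hc, rfl⟩ := hF.cover θ
  obtain ⟨w, hw⟩ := hF.exists_dual J hJ
  obtain ⟨x, hx⟩ := hh J hJ
  obtain ⟨x', hx'⟩ := hh' J hJ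
  exact affineDim_supportFace_eq hx hw hx' hc

theorem mem_supportFace_of_tightAt {h : Fin N → ℝ} {J : Finset (Fin N)}
    {x : EuclideanSpace ℝ (Fin n)} (hx : TightAt u h J x) {c : Fin N → ℝ}
    (hc : ∀ j ∈ J, 0 ≤ c j) : x ∈ supportFace (body u h) (∑ j ∈ J, c j • u j) := by
  rw [supportFace_body_eq hx hc]
  exact ⟨hx.mem_body, fun j hj _ => hx.1 j hj⟩

/-- A functional separating a point from the Minkowski sum lies in some cone of the fan. There the
vertices `x`, `x'` and `x + x'` maximize it over the three bodies, so it cannot separate. -/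
theorem IsSimplicialFan.body_add (hF : IsSimplicialFan u 𝒥) {h h' : Fin N → ℝ}
    (hh : h ∈ fanCone u 𝒥) (hh' : h' ∈ fanCone u 𝒥) (hcomp : IsCompact (body u h))
    (hcomp' : IsCompact (body u h')) : body u (h + h') = body u h + body u h' := by
  refine Set.Subset.antisymm (fun y hy => ?_) ?_
  · by_contra hcon
    obtain ⟨f, a, hf, hfy⟩ := geometric_hahn_banach_closed_point (convex_body.add convex_body)
      (hcomp.add hcomp').isClosed hcon
    obtain ⟨J, hJ, c, hc, hsum⟩ :=
      hF.cover ((InnerProductSpace.toDual ℝ (EuclideanSpace ℝ (Fin n))).symm f)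
    have hfin : ∀ z, f z = inner ℝ z (∑ j ∈ J, c j • u j) := fun z => by
      rw [hsum, real_inner_comm, InnerProductSpace.toDual_symm_apply]
    obtain ⟨x, hx⟩ := hh J hJ
    obtain ⟨x', hx'⟩ := hh' J hJ
    have h1 := (mem_supportFace_of_tightAt (hx.add hx') hc).2 y hy
    have h2 := hf _ (Set.add_mem_add hx.mem_body hx'.mem_body)
    rw [← hfin, ← hfin] at h1
    linarith
  · rintro _ ⟨y, hy, z, hz, rfl⟩ j
    rw [inner_add_left]
    exact add_le_add (hy j) (hz j)

theorem inner_sum_dual {J : Finset (Fin N)} {w : Fin N → EuclideanSpace ℝ (Fin n)}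
    (hw : IsDualBasis u J w) (b : Fin N → ℝ) {k : Fin N} (hk : k ∈ J) :
    inner ℝ (∑ j ∈ J, b j • u j) (w k) = b k := by
  rw [sum_inner, Finset.sum_congr rfl fun j hj => by
    rw [real_inner_smul_left, real_inner_comm, hw.inner_eq k hk j hj]]
  simp [hk]

/-- A body strongly isomorphic to one with simplicial normal fan has the same active sets. -/
theorem IsSimplicialFan.mem_fanCone (hF : IsSimplicialFan u 𝒥) {h₀ h : Fin N → ℝ}
    (hu : ∀ j, ‖u j‖ = 1) (hh₀ : h₀ ∈ fanCone u 𝒥) (hpos : ∀ j, 0 < h j)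
    (hcomp : IsCompact (body u h)) (hiso : StronglyIsomorphic (body u h) (body u h₀))
    (htight₀ : ∀ j, ∀ y ∈ supportFace (body u h₀) (u j), inner ℝ y (u j) = h₀ j)
    (htight : ∀ j, ∀ y ∈ supportFace (body u h) (u j), inner ℝ y (u j) = h j) :
    h ∈ fanCone u 𝒥 := by
  intro J hJ
  obtain ⟨w, hw⟩ := hF.exists_dual J hJ
  obtain ⟨x₀, hx₀⟩ := hh₀ J hJ
  have hu0 : ∀ j, u j ≠ 0 := fun j h0 => by simpa [h0] using hu j
  -- An empty basis occurs only for `n = 0`; it is split off because directions in `D` must be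
  -- nonzero.
  rcases J.eq_empty_or_nonempty with rfl | ⟨j₀, hj₀⟩
  · exact ⟨0, by simp, fun i _ => by simpa using hpos i⟩
  have h0mem : (0 : EuclideanSpace ℝ (Fin n)) ∈ body u h := fun j => by
    simpa using (hpos j).le
  set Q := body u h with hQ
  let D : Set (EuclideanSpace ℝ (Fin n)) := {θ | ∀ j ∈ J, (0 : ℝ) < inner ℝ θ (w j)}
  have hDconv : Convex ℝ D := by
    refine convex_iff_forall_pos.2 fun θ hθ η hη a b ha hb _ j hj => ?_
    rw [inner_add_left, real_inner_smul_left, real_inner_smul_left]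
    exact add_pos (mul_pos ha (hθ j hj)) (mul_pos hb (hη j hj))
  have hDsum : ∀ b : Fin N → ℝ, (∀ j ∈ J, 0 < b j) → ∑ j ∈ J, b j • u j ∈ D :=
    fun b hb j hj => by
      rw [inner_sum_dual hw b hj]
      exact hb j hj
  have hDsub : ∀ θ ∈ D, (supportFace Q θ).Subsingleton := by
    intro θ hθ
    have hθ0 : θ ≠ 0 := fun h0 => by simpa [h0] using hθ j₀ hj₀
    refine subsingleton_of_affineDim_eq_zero ((hiso.affineDim_eq hθ0).trans ?_)
    rw [hw.sum_right θ]
    exact (affineDim_supportFace_eq_zero_iff hx₀ hw fun j hj => (hθ j hj).le).2 hθ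
  have hθ₁ : ∑ j ∈ J, (1 : ℝ) • u j ∈ D := hDsum (fun _ => 1) fun _ _ => one_pos
  obtain ⟨q, hq, hqD⟩ := exists_forall_mem_supportFace hcomp ⟨0, h0mem⟩
    finite_extremePoints_body hDconv.isPreconnected ⟨_, hθ₁⟩ hDsub
  -- Each `u j` is a limit of directions `u j + ε • ∑ u k` in the open cone `D`, and maximality of
  -- `q` passes to the limit.
  have hqu : ∀ j ∈ J, q ∈ supportFace Q (u j) := by
    intro j hj
    refine ⟨hq, fun y hy => ?_⟩
    have hev : ∀ᶠ ε : ℝ in 𝓝[>] 0, inner ℝ y (u j + ε • ∑ k ∈ J, (1 : ℝ) • u k) ≤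
        inner ℝ q (u j + ε • ∑ k ∈ J, (1 : ℝ) • u k) := by
      filter_upwards [self_mem_nhdsWithin] with ε hε
      refine (hqD _ fun k hk => ?_).2 y hy
      rw [inner_add_left, real_inner_smul_left, real_inner_comm, hw.inner_eq k hk j hj]
      have := mul_pos (show (0 : ℝ) < ε from hε) (hθ₁ k hk)
      split_ifs <;> linarith
    have hlim : ∀ z : EuclideanSpace ℝ (Fin n),
        Tendsto (fun ε : ℝ => (inner ℝ z (u j + ε • ∑ k ∈ J, (1 : ℝ) • u k) : ℝ)) (𝓝[>] 0)
          (𝓝 (inner ℝ z (u j))) := fun z => by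
      have hc : Continuous fun ε : ℝ =>
        (inner ℝ z (u j + ε • ∑ k ∈ J, (1 : ℝ) • u k) : ℝ) := by fun_prop
      simpa using (hc.tendsto 0).mono_left nhdsWithin_le_nhds
    exact le_of_tendsto_of_tendsto (hlim y) (hlim q) hev
  refine ⟨q, fun j hj => htight j q (hqu j hj), fun i hi => lt_of_le_of_ne (hq i) fun hqi => ?_⟩
  -- Were a further constraint active at `q`, a direction on the boundary of the cone over `J`
  -- would have `{q}` as its support set.
  set a : Fin N → ℝ := fun j => inner ℝ (u i) (w j) with ha
  -- Otherwise `u i` would lie in the cone over `J`, and `x₀` would be tight at `i ∉ J`.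
  obtain ⟨k, hkJ, hk⟩ : ∃ k ∈ J, a k < 0 := by
    by_contra hcon
    push Not at hcon
    have hmem := mem_supportFace_of_tightAt hx₀ hcon
    rw [← hw.sum_right (u i)] at hmem
    exact (hx₀.2 i hi).ne (htight₀ i x₀ hmem)
  -- Positive weights that cancel the negative coordinates of `u i` exactly: `θ` then lies in the
  -- closed cone with zero coefficient at `k`.
  let b : Fin N → ℝ := fun j => if a j < 0 then -a j else 1
  have hb : ∀ j, 0 < b j := fun j => by
    simp only [b]; split_ifs <;> linarith
  have hab : ∀ j, 0 ≤ a j + b j := fun j => by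
    simp only [b]; split_ifs <;> linarith
  set θ := ∑ j ∈ J, (a j + b j) • u j with hθ
  have hθeq : θ = u i + ∑ j ∈ J, b j • u j := by
    conv_rhs => rw [hw.sum_right (u i)]
    rw [hθ, ← Finset.sum_add_distrib]
    simp only [add_smul, ha]
  have hqi' : q ∈ supportFace Q (u i) := ⟨hq, fun y hy => by rw [hqi]; exact hy i⟩
  have hbD := hDsum b fun j _ => hb j
  -- `q` maximizes both summands of `θ`, so any maximizer of `θ` also maximizes the summand in `D`,
  -- whose face is a point.
  have hsub : (supportFace Q θ).Subsingleton := by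
    have hsubset : supportFace Q θ ⊆ supportFace Q (∑ j ∈ J, b j • u j) := by
      intro y hy
      refine ⟨hy.1, fun z hz => ?_⟩
      have h1 := hy.2 q hq
      rw [hθeq, inner_add_right, inner_add_right] at h1
      have h2 := hqi'.2 y hy.1
      have h3 := (hqD _ hbD).2 z hz
      linarith
    exact (hDsub _ hbD).anti hsubset
  by_cases hθ0 : θ = 0
  · have hQsub : Q.Subsingleton := fun y hy z hz =>
      hsub ⟨hy, fun _ _ => by simp [hθ0]⟩ ⟨hz, fun _ _ => by simp [hθ0]⟩
    have hmem : q = 0 := hQsub hq h0mem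
    have := hpos i
    rw [← hqi, hmem, inner_zero_left] at this
    exact lt_irrefl _ this
  · have hdim := (hiso.affineDim_eq hθ0).symm.trans (affineDim_eq_zero_of_subsingleton hsub)
    have := (affineDim_supportFace_eq_zero_iff hx₀ hw fun j _ => hab j).1 hdim k hkJ
    simp [b, hk] at this

end Fan
-- The normal fan of a simple polytope and its type cone.
section VertexFan

variable {n N : ℕ} {u : Fin N → EuclideanSpace ℝ (Fin n)} {h : Fin N → ℝ}

/-- The active sets of the vertices of a body. -/
def vertexActiveSets (u : Fin N → EuclideanSpace ℝ (Fin n)) (h : Fin N → ℝ) :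
    Set (Finset (Fin N)) :=
  {J | ∃ v ∈ Set.extremePoints ℝ (body u h), ∀ j, j ∈ J ↔ inner ℝ v (u j) = h j}

theorem tightAt_of_mem_iff {v : EuclideanSpace ℝ (Fin n)} (hv : v ∈ body u h)
    {J : Finset (Fin N)} (hJ : ∀ j, j ∈ J ↔ inner ℝ v (u j) = h j) : TightAt u h J v :=
  ⟨fun j hj => (hJ j).1 hj, fun j hj => lt_of_le_of_ne (hv j) fun e => hj ((hJ j).2 e)⟩

theorem mem_fanCone_vertexActiveSets : h ∈ fanCone u (vertexActiveSets u h) := by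
  rintro J ⟨v, hv, hJ⟩
  exact ⟨v, tightAt_of_mem_iff hv.1 hJ⟩

variable (hu_inj : Function.Injective u) (hu : Set.range u = facetNormals (body u h))

include hu in
theorem mem_facetNormals (j : Fin N) : u j ∈ facetNormals (body u h) :=
  hu ▸ Set.mem_range_self j

include hu_inj hu in
theorem inner_eq_of_mem_supportFace_normal (j : Fin N) {y : EuclideanSpace ℝ (Fin n)}
    (hy : y ∈ supportFace (body u h) (u j)) : inner ℝ y (u j) = h j :=
  inner_eq_of_mem_facet hu_inj (fun i => (mem_facetNormals hu i).1) (mem_facetNormals hu j).2.2 hy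

-- Normals of one common facet agree up to sign; opposite signs would put the body in a hyperplane,
-- against its nonempty interior.
include hu_inj hu in
theorem injective_supportFace (hint : (interior (body u h)).Nonempty) :
    Function.Injective fun j => supportFace (body u h) (u j) := by
  intro i j hij
  have hij' : supportFace (body u h) (u i) = supportFace (body u h) (u j) := hij
  obtain ⟨p, hp⟩ := hint
  have hfn := mem_facetNormals hu
  have hne : ∀ k, u k ≠ 0 := fun k h0 => by simpa [h0] using (hfn k).1
  rcases eq_or_eq_neg_of_orthogonal _ (hfn i).2.2 (hfn i).1 (hfn j).1
    (fun v hv => inner_eq_zero_of_mem_vectorSpan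
      (fun a ha b hb => inner_eq_of_mem_supportFace ha hb) hv)
    (fun v hv => inner_eq_zero_of_mem_vectorSpan
      (fun a ha b hb => inner_eq_of_mem_supportFace (hij' ▸ ha) (hij' ▸ hb)) hv) with e | e
  · exact (hu_inj e).symm
  · exfalso
    obtain ⟨x, hx⟩ := (hfn i).2.1
    have hi := inner_eq_of_mem_supportFace_normal hu_inj hu i hx
    have hj := inner_eq_of_mem_supportFace_normal hu_inj hu j (hij' ▸ hx)
    have h1 := inner_lt_of_mem_interior_body hp (hne i)
    have h2 := inner_lt_of_mem_interior_body hp (hne j)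
    rw [← hi] at h1
    rw [← hj, e, inner_neg_right, inner_neg_right] at h2
    linarith

-- Constraints active at a vertex correspond bijectively to the facets through it; this is where
-- simplicity enters.
include hu_inj hu in
theorem card_vertexActiveSet (hint : (interior (body u h)).Nonempty)
    (hsimple : IsSimple (body u h)) {J : Finset (Fin N)} (hJ : J ∈ vertexActiveSets u h) :
    J.card = n := by
  obtain ⟨v, hv, hJ⟩ := hJ
  have hset : {F ∈ facets (body u h) | v ∈ F} =
      (fun j => supportFace (body u h) (u j)) '' (J : Set (Fin N)) := by
    ext F
    simp only [facets, ← hu, Set.mem_ofPred_eq, Set.mem_image, Set.mem_range, Finset.mem_coe]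
    constructor
    · rintro ⟨⟨_, ⟨j, rfl⟩, rfl⟩, hvF⟩
      exact ⟨j, (hJ j).2 (inner_eq_of_mem_supportFace_normal hu_inj hu j hvF), rfl⟩
    · rintro ⟨j, hj, rfl⟩
      exact ⟨⟨u j, ⟨j, rfl⟩, rfl⟩, hv.1, fun y hy => by rw [(hJ j).1 hj]; exact hy j⟩
  have hcard := hsimple v hv
  rw [hset, (injective_supportFace hu_inj hu hint).encard_image, Set.encard_coe_eq_coe_finsetCard]
    at hcard
  exact_mod_cast hcard

include hu_inj hu in
/-- The normal fan of a simple polytope is simplicial. -/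
theorem isSimplicialFan_vertexActiveSets (hcomp : IsCompact (body u h))
    (hint : (interior (body u h)).Nonempty) (hsimple : IsSimple (body u h)) :
    IsSimplicialFan u (vertexActiveSets u h) := by
  have hdual : ∀ J ∈ vertexActiveSets u h, ∃ w, IsDualBasis u J w := fun J hJ => by
    refine exists_isDualBasis (card_vertexActiveSet hu_inj hu hint hsimple hJ) fun z hz => ?_
    obtain ⟨v, hv, hJv⟩ := hJ
    exact eq_zero_of_inner_active hv fun j hj => hz j ((hJv j).2 hj)
  refine ⟨hdual, fun θ => ?_⟩
  obtain ⟨v, hv, hvθ⟩ :=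
    exists_extremePoint_mem_supportFace hcomp (hint.mono interior_subset) θ
  classical
  have hJ : ∀ j, j ∈ Finset.univ.filter (fun j => inner ℝ v (u j) = h j) ↔
      inner ℝ v (u j) = h j := fun j => by simp
  have hmem : Finset.univ.filter (fun j => inner ℝ v (u j) = h j) ∈ vertexActiveSets u h :=
    ⟨v, hv, hJ⟩
  obtain ⟨w, hw⟩ := hdual _ hmem
  exact ⟨_, hmem, fun j => inner ℝ θ (w j),
    fun j hj => (tightAt_of_mem_iff hv.1 hJ).inner_nonneg hw hvθ hj, (hw.sum_right θ).symm⟩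

include hu in
theorem inner_eq_of_stronglyIsomorphic (hu_inj : Function.Injective u) {h' : Fin N → ℝ}
    (hiso : StronglyIsomorphic (body u h') (body u h)) (j : Fin N)
    {y : EuclideanSpace ℝ (Fin n)} (hy : y ∈ supportFace (body u h') (u j)) :
    inner ℝ y (u j) = h' j := by
  have hfn := mem_facetNormals hu
  exact inner_eq_of_mem_facet hu_inj (fun i => (hfn i).1)
    (by rw [hiso _ (hfn j).1]; exact (hfn j).2.2) hy

include hu_inj hu in
/-- The type cone is the positive part of the cone of the normal fan. -/
theorem typeCone_eq (hcomp : IsCompact (body u h)) (hint : (interior (body u h)).Nonempty)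
    (hsimple : IsSimple (body u h)) :
    typeCone (body u h) u = {h' | ∀ j, 0 < h' j} ∩ fanCone u (vertexActiveSets u h) := by
  have hF := isSimplicialFan_vertexActiveSets hu_inj hu hcomp hint hsimple
  have hfn := mem_facetNormals hu
  obtain ⟨p, hp⟩ := hint
  have hplt : ∀ j, inner ℝ p (u j) < h j := fun j =>
    inner_lt_of_mem_interior_body hp fun h0 => by simpa [h0] using (hfn j).1
  ext h'
  refine and_congr_right fun hpos => ⟨fun hiso => ?_, fun hh' =>
    hF.stronglyIsomorphic hh' mem_fanCone_vertexActiveSets⟩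
  exact hF.mem_fanCone (fun j => (hfn j).1) mem_fanCone_vertexActiveSets hpos
    (isCompact_body hcomp hplt) hiso
    (fun j _ hy => inner_eq_of_mem_supportFace_normal hu_inj hu j hy)
    (fun j _ hy => inner_eq_of_stronglyIsomorphic hu hu_inj hiso j hy)

/-- Translating the body by `-p` keeps all active sets. With `p` interior the new right-hand side is
positive, so the type cone is nonempty. -/
theorem sub_inner_mem_fanCone {𝒥 : Set (Finset (Fin N))} (hh : h ∈ fanCone u 𝒥)
    (p : EuclideanSpace ℝ (Fin n)) : (fun j => h j - inner ℝ p (u j)) ∈ fanCone u 𝒥 := by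
  intro J hJ
  obtain ⟨x, hx⟩ := hh J hJ
  exact ⟨x - p, fun j hj => by rw [inner_sub_left, hx.1 j hj],
    fun j hj => by rw [inner_sub_left]; exact sub_lt_sub_right (hx.2 j hj) _⟩

theorem facetNormals_eq_of_stronglyIsomorphic {K L : Set (EuclideanSpace ℝ (Fin n))}
    (hK : IsCompact K) (hKne : K.Nonempty) (hL : IsCompact L) (hLne : L.Nonempty)
    (hKL : StronglyIsomorphic K L) : facetNormals K = facetNormals L := by
  ext θ
  refine and_congr_right fun hθ => ?_
  rw [hKL θ hθ]
  simp [supportFace_nonempty hK hKne, supportFace_nonempty hL hLne]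

end VertexFan

end SimplePolytope

/-! ### Assembly of the three claims. -/

open SimplePolytope in
theorem mainTheorem4 {n N : ℕ} (K : Set (EuclideanSpace ℝ (Fin n)))
    (hK : SimplePolytope.IsPolytope K) (hint : (interior K).Nonempty)
    (hsimple : SimplePolytope.IsSimple K)
    (u : Fin N → EuclideanSpace ℝ (Fin n)) (hu_inj : Function.Injective u)
    (hu : Set.range u = SimplePolytope.facetNormals K) :
    (IsOpen (SimplePolytope.typeCone K u) ∧ Convex ℝ (SimplePolytope.typeCone K u) ∧
      (SimplePolytope.typeCone K u).Nonempty ∧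
      ∀ h ∈ SimplePolytope.typeCone K u, ∀ t : ℝ, 0 < t →
        t • h ∈ SimplePolytope.typeCone K u) ∧
    (∀ P : Set (EuclideanSpace ℝ (Fin n)), SimplePolytope.IsPolytope P →
      SimplePolytope.StronglyIsomorphic P K → 0 ∈ interior P →
      ∃! h : Fin N → ℝ, h ∈ SimplePolytope.typeCone K u ∧ P = SimplePolytope.body u h) ∧
    (∀ h ∈ SimplePolytope.typeCone K u, ∀ h' ∈ SimplePolytope.typeCone K u,
      SimplePolytope.body u (h + h') = SimplePolytope.body u h + SimplePolytope.body u h') := by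
  have hcomp := hK.isCompact
  obtain ⟨h₀, rfl⟩ := hK.eq_body hint hu
  have hF := isSimplicialFan_vertexActiveSets hu_inj hu hcomp hint hsimple
  have hC := typeCone_eq hu_inj hu hcomp hint hsimple
  have hne : ∀ j, u j ≠ 0 := fun j h0 => by simpa [h0] using (mem_facetNormals hu j).1
  obtain ⟨p, hp⟩ := hint
  have hplt : ∀ j, inner ℝ p (u j) < h₀ j := fun j => inner_lt_of_mem_interior_body hp (hne j)
  refine ⟨?_, ?_, ?_⟩
  · have hpos : {h : Fin N → ℝ | ∀ j, 0 < h j} = ⋂ j, {h | 0 < h j} := by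
      ext h; simp
    rw [hC]
    refine ⟨IsOpen.inter ?_ hF.isOpen_fanCone, Convex.inter ?_ convex_fanCone,
      ⟨fun j => h₀ j - inner ℝ p (u j), fun j => sub_pos.2 (hplt j),
        sub_inner_mem_fanCone mem_fanCone_vertexActiveSets p⟩,
      fun h hh t ht => ⟨fun j => mul_pos ht (hh.1 j), smul_mem_fanCone hh.2 ht⟩⟩
    · rw [hpos]
      exact isOpen_iInter_of_finite fun j => isOpen_lt continuous_const (continuous_apply j)
    · exact convex_iff_forall_pos.2 fun x hx y hy a b ha hb _ j =>
        add_pos (mul_pos ha (hx j)) (mul_pos hb (hy j))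
  · intro P hP hiso h0
    have huP : Set.range u = facetNormals P := hu.trans
      (facetNormals_eq_of_stronglyIsomorphic hP.isCompact ⟨0, interior_subset h0⟩ hcomp
        ⟨p, interior_subset hp⟩ hiso).symm
    obtain ⟨h, rfl⟩ := hP.eq_body ⟨0, h0⟩ huP
    refine ⟨h, ⟨⟨fun j => ?_, hiso⟩, rfl⟩, ?_⟩
    · simpa using inner_lt_of_mem_interior_body h0 (hne j)
    -- Both `h j` and `h' j` equal the value of `⟨·, u j⟩` at a point of the same facet.
    · rintro h' ⟨⟨-, hiso'⟩, heq⟩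
      funext j
      obtain ⟨y, hy⟩ := (mem_facetNormals huP j).2.1
      rw [← inner_eq_of_mem_supportFace_normal hu_inj huP j hy,
        inner_eq_of_stronglyIsomorphic hu hu_inj hiso' j (heq ▸ hy)]
  · intro h hh h' hh'
    rw [hC] at hh hh'
    exact hF.body_add hh.2 hh'.2 (isCompact_body hcomp hplt) (isCompact_body hcomp hplt)
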